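/- Let $R$ be a commutative unital ring, let $\mathscr{A}$ be a set (the alphabet), let $F\subseteq\mathscr{A}^*$ be a set of finite words, and let $X=X_F\subseteq\mathscr{A}^{\mathbb N}$ be the subshift of all sequences in which no word of $F$ occurs. Assume that every letter of $\mathscr{A}$ occurs in some element of $X$. Let $\mathcal{L}_X$ be the language of $X$, i.e. the set of all finite words (including the empty word $\omega$) that occur in elements of $X$. For $\alpha,\beta\in\mathcal{L}_X$ put $C(\alpha,\beta)=\{\beta x\in X:\alpha x\in X\}$, and let $\mathcal{U}$ be the Boolean algebra of subsets of $X$ generated by all the sets $C(\alpha,\beta)$, $\alpha,\beta\in\mathcal{L}_X$. The unital subshift algebra $\widetilde{\mathcal{A}}_R(X)$ is the universal unital $R$-algebra with generators $\{p_A:A\in\mathcal{U}\}$ and $\{s_a,s_a^*:a\in\mathscr{A}\}$, subject to the relations 1. $p_X=1$, $p_\emptyset=0$, $p_{A\cap B}=p_Ap_B$ and $p_{A\cup B}=p_A+p_B-p_{A\cap B}$ for all $A,B\in\mathcal{U}$; 2. $s_as_a^*s_a=s_a$ and $s_a^*s_as_a^*=s_a^*$ for all $a\in\mathscr{A}$;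 3. $s_\beta s_\alpha^*s_\alpha s_\beta^*=p_{C(\alpha,\beta)}$ for all $\alpha,\beta\in\mathcal{L}_X$, where $s_{\alpha_1\cdots\alpha_n}=s_{\alpha_1}\cdots s_{\alpha_n}$, $s_{\alpha_1\cdots\alpha_n}^*=s_{\alpha_n}^*\cdots s_{\alpha_1}^*$ and $s_\omega=s_\omega^*=1$. It is equipped with the $\mathbb{Z}$-grading whose homogeneous component of degree $n$ is $$\widetilde{\mathcal{A}}_R(X)_n=\operatorname{span}_R\{s_\alpha p_As_\beta^*:\alpha,\beta\in\mathcal{L}_X,\ A\in\mathcal{U},\ |\alpha|-|\beta|=n\}.$$ Let $S=\bigoplus_{n\in\mathbb{Z}}S_n$ be a $\mathbb{Z}$-graded ring (associative, not necessarily unital; the $S_n$ are additive subgroups with $S_mS_n\subseteq S_{m+n}$), and let $\eta:\widetilde{\mathcal{A}}_R(X)\to S$ be a ring homomorphism (additive and multiplicative, not necessarily unital) with $\eta(\widetilde{\mathcal{A}}_R(X)_n)\subseteq S_n$ for all $n\in\mathbb{Z}$. If $\eta(rp_A)\neq 0$ for every nonzero $r\in R$ and every nonempty $A\in\mathcal{U}$,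 then $\eta$ is injective. -/

import Mathlib

namespace SubshiftAlgebra

universe u v

/-- The subshift determined by a set `F` of forbidden words: all sequences over `𝒜` in which no
word of `F` appears at any position. Sequences are `Stream' 𝒜`, which unfolds to `ℕ → 𝒜`;
words are lists. -/
def subshift {𝒜 : Type u} (F : Set (List 𝒜)) : Set (Stream' 𝒜) :=
  {x | ∀ w ∈ F, ∀ k : ℕ, (x.drop k).take w.length ≠ w}

/-- The property of being the subshift of some set of forbidden words. -/
def IsSubshift {𝒜 : Type u} (X : Set (Stream' 𝒜)) : Prop :=
  ∃ F : Set (List 𝒜), X = subshift F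

/-- The language of `X`: all words that are initial segments of elements of `X`. (For a shift
invariant set these are the words that appear anywhere in an element of `X`.) -/
def language {𝒜 : Type u} (X : Set (Stream' 𝒜)) : Set (List 𝒜) :=
  {w | ∃ x ∈ X, x.take w.length = w}

/-- The set `C(α, β) = {βx ∈ X : αx ∈ X}`, as a set of points of `X`. -/
def C {𝒜 : Type u} (X : Set (Stream' 𝒜)) (α β : List 𝒜) : Set X :=
  {y | ∃ x : Stream' 𝒜, (y : Stream' 𝒜) = β ++ₛ x ∧ α ++ₛ x ∈ X}

/-- The Boolean algebra of subsets of `X` generated by all `C(α, β)`, with `α, β` in the language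
of `X`. -/
def U {𝒜 : Type u} (X : Set (Stream' 𝒜)) : BooleanSubalgebra (Set X) :=
  BooleanSubalgebra.closure {A | ∃ α ∈ language X, ∃ β ∈ language X, A = C X α β}

/-- `C(α, β)` as an element of the Boolean algebra `U X`. -/
def CU {𝒜 : Type u} (X : Set (Stream' 𝒜)) (α β : List 𝒜)
    (hα : α ∈ language X) (hβ : β ∈ language X) : U X :=
  ⟨C X α β, BooleanSubalgebra.subset_closure ⟨α, hα, β, hβ, rfl⟩⟩

/-- The symbols `p_A` (for `A ∈ U X`), `s_a` and `s_a^*` (for letters `a`). -/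
inductive Gen {𝒜 : Type u} (X : Set (Stream' 𝒜)) : Type u
  | p (A : U X) : Gen X
  | s (a : 𝒜) : Gen X
  | sStar (a : 𝒜) : Gen X

section Free

variable (R : Type v) [CommRing R] {𝒜 : Type u} (X : Set (Stream' 𝒜))

/-- The generator `p_A` in the free algebra. -/
def freeP (A : U X) : FreeAlgebra R (Gen X) := FreeAlgebra.ι R (Gen.p A)

/-- The generator `s_a` in the free algebra. -/
def freeS (a : 𝒜) : FreeAlgebra R (Gen X) := FreeAlgebra.ι R (Gen.s a)

/-- The generator `s_a^*` in the free algebra. -/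
def freeSStar (a : 𝒜) : FreeAlgebra R (Gen X) := FreeAlgebra.ι R (Gen.sStar a)

/-- `s_α = s_{α₁} ⋯ s_{αₙ}` in the free algebra, equal to `1` for the empty word. -/
def freeSWord (α : List 𝒜) : FreeAlgebra R (Gen X) := (α.map (freeS R X)).prod

/-- `s_α^* = s_{αₙ}^* ⋯ s_{α₁}^*` in the free algebra, equal to `1` for the empty word. -/
def freeSStarWord (α : List 𝒜) : FreeAlgebra R (Gen X) := (α.reverse.map (freeSStar R X)).prod

/-- The defining relations of the unital subshift algebra. -/
inductive Rel : FreeAlgebra R (Gen X) → FreeAlgebra R (Gen X) → Prop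
  | p_top : Rel (freeP R X ⊤) 1
  | p_inf (A B : U X) : Rel (freeP R X (A ⊓ B)) (freeP R X A * freeP R X B)
  | p_sup (A B : U X) :
      Rel (freeP R X (A ⊔ B)) (freeP R X A + freeP R X B - freeP R X (A ⊓ B))
  | p_bot : Rel (freeP R X ⊥) 0
  | s_sStar_s (a : 𝒜) : Rel (freeS R X a * freeSStar R X a * freeS R X a) (freeS R X a)
  | sStar_s_sStar (a : 𝒜) :
      Rel (freeSStar R X a * freeS R X a * freeSStar R X a) (freeSStar R X a)
  | p_C (α β : List 𝒜) (hα : α ∈ language X) (hβ : β ∈ language X) :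
      Rel (freeSWord R X β * freeSStarWord R X α * freeSWord R X α * freeSStarWord R X β)
        (freeP R X (CU X α β hα hβ))

end Free

/-- The unital subshift algebra of `X` over `R`: the universal unital `R`-algebra on the symbols
`p_A`, `s_a`, `s_a^*` subject to the relations `Rel R X`. -/
abbrev UnitalSubshiftAlgebra (R : Type v) [CommRing R] {𝒜 : Type u} (X : Set (Stream' 𝒜)) :
    Type (max u v) :=
  RingQuot (Rel R X)

section Algebra

variable (R : Type v) [CommRing R] {𝒜 : Type u} (X : Set (Stream' 𝒜))

/-- The generator `p_A` of the unital subshift algebra. -/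
noncomputable def p (A : U X) : UnitalSubshiftAlgebra R X :=
  RingQuot.mkAlgHom R (Rel R X) (freeP R X A)

/-- The generator `s_a` of the unital subshift algebra. -/
noncomputable def s (a : 𝒜) : UnitalSubshiftAlgebra R X :=
  RingQuot.mkAlgHom R (Rel R X) (freeS R X a)

/-- The generator `s_a^*` of the unital subshift algebra. -/
noncomputable def sStar (a : 𝒜) : UnitalSubshiftAlgebra R X :=
  RingQuot.mkAlgHom R (Rel R X) (freeSStar R X a)

/-- `s_α = s_{α₁} ⋯ s_{αₙ}`. -/
noncomputable def sWord (α : List 𝒜) : UnitalSubshiftAlgebra R X := (α.map (s R X)).prod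

/-- `s_α^* = s_{αₙ}^* ⋯ s_{α₁}^*`. -/
noncomputable def sStarWord (α : List 𝒜) : UnitalSubshiftAlgebra R X :=
  (α.reverse.map (sStar R X)).prod

/-- The homogeneous component of degree `n` of the unital subshift algebra: the `R`-span of all
`s_α p_A s_β^*` with `|α| - |β| = n`. -/
noncomputable def component (n : ℤ) : Submodule R (UnitalSubshiftAlgebra R X) :=
  Submodule.span R
    {x | ∃ α ∈ language X, ∃ β ∈ language X, ∃ A : U X,
      (α.length : ℤ) - (β.length : ℤ) = n ∧ x = sWord R X α * p R X A * sStarWord R X β}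

end Algebra

end SubshiftAlgebra

/-! Since `η` maps components into the summands of `S`, and the components span the algebra, it is
enough that `η` kills no nonzero homogeneous element. Every `p_A` can be moved past `s_a` and
`s_a^*`, so the elements `s_α p_A s_β^*` span. Multiplying by `s_a^*` on the left or by `s_b` on the
right cancels a letter and preserves the kernel of `η`; this drives inductions on the degree and on
the word length.

The alphabet may be infinite, so `∑ s_a s_a^* = 1` cannot be used to recover `x` from the products
`s_a^* x`. The substitute is a cut (`IsCut`, `exists_isCut_left`): only finitely many first letters
occur in `x`, and the product `q` of the `1 - s_a s_a^*` over them kills every term with `α`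
nonempty, yet fixes any `y` with `s_a^* y = 0` for all `a`. In positive degree all terms have `α`
nonempty, so `x = q x = 0` once all `s_a^* x` vanish; negative degree is symmetric. In degree zero,
cuts on both sides reduce to the span of the `p_A`, where `x` acts on small enough `p_B` as a scalar
`r` and the hypothesis forces `r p_B = 0` (`eq_zero_of_mem_span_p`). -/

namespace SubshiftAlgebra

/-! ### Words of the language and disjointness of cylinder and follower sets. -/

section Language

variable {𝒜 : Type*} {X : Set (Stream' 𝒜)}

theorem IsSubshift.tail_mem (hX : IsSubshift X) {x : Stream' 𝒜} (hx : x ∈ X) : x.tail ∈ X := by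
  obtain ⟨F, rfl⟩ := hX
  intro w hw k
  rw [← Stream'.drop_succ]
  exact hx w hw (k + 1)

theorem mem_language_iff {α : List 𝒜} : α ∈ language X ↔ ∃ x : Stream' 𝒜, α ++ₛ x ∈ X := by
  constructor
  · rintro ⟨x, hx, h⟩
    refine ⟨x.drop α.length, ?_⟩
    have := Stream'.append_take_drop α.length x
    rw [h] at this
    rwa [this]
  · rintro ⟨x, hx⟩
    exact ⟨_, hx, by simp [Stream'.take_append_of_le_length]⟩

theorem IsSubshift.mem_language_of_cons (hX : IsSubshift X) {a : 𝒜} {α : List 𝒜}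
    (h : a :: α ∈ language X) : α ∈ language X := by
  obtain ⟨x, hx⟩ := mem_language_iff.1 h
  exact mem_language_iff.2 ⟨x, hX.tail_mem hx⟩

theorem nil_mem_language_of_mem {α : List 𝒜} (h : α ∈ language X) : [] ∈ language X := by
  obtain ⟨x, hx, -⟩ := h
  exact ⟨x, hx, rfl⟩

theorem CU_inf_eq_bot_of_ne (h : [] ∈ language X) {a b : 𝒜} (hab : a ≠ b)
    (ha : [a] ∈ language X) (hb : [b] ∈ language X) : CU X [] [a] h ha ⊓ CU X [] [b] h hb = ⊥ := by
  apply Subtype.ext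
  refine Set.eq_empty_iff_forall_notMem.2 ?_
  rintro y ⟨⟨x, hx, -⟩, ⟨z, hz, -⟩⟩
  exact hab (congrArg Stream'.head (hx.symm.trans hz))

/-- Words `α` and `β` whose concatenation is not allowed have disjoint follower set of `α` and
cylinder set of `β`. -/
theorem CU_inf_eq_bot_of_append_notMem (h : [] ∈ language X) {α β : List 𝒜}
    (hα : α ∈ language X) (hβ : β ∈ language X) (hαβ : α ++ β ∉ language X) :
    CU X α [] hα h ⊓ CU X [] β h hβ = ⊥ := by
  apply Subtype.ext
  refine Set.eq_empty_iff_forall_notMem.2 ?_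
  rintro y ⟨⟨x, hx, hx'⟩, ⟨z, hz, -⟩⟩
  refine hαβ (mem_language_iff.2 ⟨z, ?_⟩)
  rw [Stream'.append_append_stream, ← hz, hx]
  exact hx'

end Language

/-! ### The defining relations inside the algebra. -/

section Relations

variable {R : Type*} [CommRing R] {𝒜 : Type*} {X : Set (Stream' 𝒜)}

theorem mkAlgHom_freeSWord (α : List 𝒜) :
    RingQuot.mkAlgHom R (Rel R X) (freeSWord R X α) = sWord R X α := by
  simp [freeSWord, sWord, map_list_prod, Function.comp_def]
  rfl

theorem mkAlgHom_freeSStarWord (α : List 𝒜) :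
    RingQuot.mkAlgHom R (Rel R X) (freeSStarWord R X α) = sStarWord R X α := by
  simp [freeSStarWord, sStarWord, map_list_prod, Function.comp_def]
  rfl

@[simp] theorem p_top : p R X ⊤ = 1 := by
  simpa [p] using RingQuot.mkAlgHom_rel R (Rel.p_top (R := R) (X := X))

@[simp] theorem p_bot : p R X ⊥ = 0 := by
  simpa [p] using RingQuot.mkAlgHom_rel R (Rel.p_bot (R := R) (X := X))

theorem p_mul_p (A B : U X) : p R X A * p R X B = p R X (A ⊓ B) := by
  simpa [p] using (RingQuot.mkAlgHom_rel R (Rel.p_inf (R := R) A B)).symm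

theorem p_sup (A B : U X) : p R X (A ⊔ B) = p R X A + p R X B - p R X (A ⊓ B) := by
  simpa [p] using RingQuot.mkAlgHom_rel R (Rel.p_sup (R := R) A B)

theorem p_compl (A : U X) : p R X Aᶜ = 1 - p R X A := by
  have h := p_sup (R := R) A Aᶜ
  rw [sup_compl_eq_top, inf_compl_eq_bot, p_top, p_bot] at h
  rw [h]; abel

theorem p_comm (A B : U X) : p R X A * p R X B = p R X B * p R X A := by
  rw [p_mul_p, p_mul_p, inf_comm]

theorem s_mul_sStar_mul_s (a : 𝒜) : s R X a * sStar R X a * s R X a = s R X a := by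
  simpa [s, sStar] using RingQuot.mkAlgHom_rel R (Rel.s_sStar_s (R := R) (X := X) a)

theorem sStar_mul_s_mul_sStar (a : 𝒜) : sStar R X a * s R X a * sStar R X a = sStar R X a := by
  simpa [s, sStar] using RingQuot.mkAlgHom_rel R (Rel.sStar_s_sStar (R := R) (X := X) a)

@[simp] theorem sWord_nil : sWord R X [] = 1 := rfl

@[simp] theorem sStarWord_nil : sStarWord R X [] = 1 := rfl

theorem sWord_cons (a : 𝒜) (α : List 𝒜) : sWord R X (a :: α) = s R X a * sWord R X α := by
  simp [sWord]

theorem sStarWord_cons (a : 𝒜) (α : List 𝒜) :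
    sStarWord R X (a :: α) = sStarWord R X α * sStar R X a := by
  simp [sStarWord]

theorem sWord_append (α β : List 𝒜) :
    sWord R X (α ++ β) = sWord R X α * sWord R X β := by
  simp [sWord]

theorem sStarWord_append (α β : List 𝒜) :
    sStarWord R X (α ++ β) = sStarWord R X β * sStarWord R X α := by
  simp [sStarWord]

theorem p_CU {α β : List 𝒜} (hα : α ∈ language X) (hβ : β ∈ language X) :
    p R X (CU X α β hα hβ) =
      sWord R X β * sStarWord R X α * sWord R X α * sStarWord R X β := by
  simpa [p, mkAlgHom_freeSWord, mkAlgHom_freeSStarWord] using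
    (RingQuot.mkAlgHom_rel R (Rel.p_C (R := R) α β hα hβ)).symm

/-- The cylinder projection of a word. -/
theorem p_CU_nil_left {β : List 𝒜} (h : [] ∈ language X) (hβ : β ∈ language X) :
    p R X (CU X [] β h hβ) = sWord R X β * sStarWord R X β := by
  simp [p_CU]

/-- The follower projection of a word. -/
theorem p_CU_nil_right {α : List 𝒜} (h : [] ∈ language X) (hα : α ∈ language X) :
    p R X (CU X α [] hα h) = sStarWord R X α * sWord R X α := by
  simp [p_CU]

theorem p_CU_nil_singleton {a : 𝒜} (h : [] ∈ language X) (ha : [a] ∈ language X) :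
    p R X (CU X [] [a] h ha) = s R X a * sStar R X a := by
  simp [p_CU, sWord_cons, sStarWord_cons]

theorem p_CU_singleton_nil {a : 𝒜} (h : [] ∈ language X) (ha : [a] ∈ language X) :
    p R X (CU X [a] [] ha h) = sStar R X a * s R X a := by
  simp [p_CU, sWord_cons, sStarWord_cons]

theorem sStar_mul_s_of_ne (hletters : ∀ a : 𝒜, [a] ∈ language X) {a b : 𝒜} (hab : a ≠ b) : sStar R X a * s R X b = 0 := by
  have h := nil_mem_language_of_mem (hletters a)
  have h0 : s R X a * sStar R X a * (s R X b * sStar R X b) = 0 := by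
    rw [← p_CU_nil_singleton h (hletters a), ← p_CU_nil_singleton h (hletters b), p_mul_p,
      CU_inf_eq_bot_of_ne h hab, p_bot]
  rw [← sStar_mul_s_mul_sStar a, ← s_mul_sStar_mul_s b]
  calc _ = sStar R X a * (s R X a * sStar R X a * (s R X b * sStar R X b)) * s R X b := by
        noncomm_ring
    _ = 0 := by rw [h0]; simp

end Relations

/-! ### Words as partial isometries, and moving projections past letters. -/

section Commutation

variable {R : Type*} [CommRing R] {𝒜 : Type*} {X : Set (Stream' 𝒜)}

/-- The projections `s_a^* s_a` and `s_α s_α^*` are both of the form `p_A`, hence commute; this lets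
the relation for a letter be separated from the one for the remaining word. -/
theorem sWord_mul_sStarWord_mul_sWord (hX : IsSubshift X) (hletters : ∀ a : 𝒜, [a] ∈ language X)
    {α : List 𝒜} (hα : α ∈ language X) :
    sWord R X α * sStarWord R X α * sWord R X α = sWord R X α := by
  induction α with
  | nil => simp
  | cons a α ih =>
    have h := nil_mem_language_of_mem hα
    have hα' := hX.mem_language_of_cons hα
    have hc := p_comm (R := R) (CU X [a] [] (hletters a) h) (CU X [] α h hα')
    rw [p_CU_singleton_nil, p_CU_nil_left] at hc
    rw [sWord_cons, sStarWord_cons]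
    calc _ = s R X a * (sWord R X α * sStarWord R X α * (sStar R X a * s R X a)) *
          sWord R X α := by noncomm_ring
      _ = (s R X a * sStar R X a * s R X a) *
          (sWord R X α * sStarWord R X α * sWord R X α) := by rw [← hc]; noncomm_ring
      _ = _ := by rw [s_mul_sStar_mul_s, ih hα']

theorem sStarWord_mul_sWord_mul_sStarWord (hX : IsSubshift X)
    (hletters : ∀ a : 𝒜, [a] ∈ language X) {α : List 𝒜} (hα : α ∈ language X) :
    sStarWord R X α * sWord R X α * sStarWord R X α = sStarWord R X α := by
  induction α with
  | nil => simp
  | cons a α ih =>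
    have h := nil_mem_language_of_mem hα
    have hα' := hX.mem_language_of_cons hα
    have hc := p_comm (R := R) (CU X [a] [] (hletters a) h) (CU X [] α h hα')
    rw [p_CU_singleton_nil, p_CU_nil_left] at hc
    rw [sWord_cons, sStarWord_cons]
    calc _ = sStarWord R X α * (sStar R X a * s R X a * (sWord R X α * sStarWord R X α)) *
          sStar R X a := by noncomm_ring
      _ = (sStarWord R X α * sWord R X α * sStarWord R X α) *
          (sStar R X a * s R X a * sStar R X a) := by rw [hc]; noncomm_ring
      _ = _ := by rw [sStar_mul_s_mul_sStar, ih hα']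

theorem sStarWord_mul_sWord_mul_s_mul_sStar (hletters : ∀ a : 𝒜, [a] ∈ language X)
    {α : List 𝒜} (hα : α ∈ language X) {a : 𝒜} (ha : α ++ [a] ∉ language X) :
    sStarWord R X α * sWord R X α * (s R X a * sStar R X a) = 0 := by
  have h := nil_mem_language_of_mem hα
  rw [← p_CU_nil_right h hα, ← p_CU_nil_singleton h (hletters a), p_mul_p,
    CU_inf_eq_bot_of_append_notMem h hα _ ha, p_bot]

/-- At the first letter `a` that leaves the language, `s_α s_a = s_α (s_α^* s_α)(s_a s_a^*) s_a`,
and the middle product is the projection of an empty set. -/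
theorem sWord_eq_zero (hX : IsSubshift X) (hletters : ∀ a : 𝒜, [a] ∈ language X)
    (h : [] ∈ language X) {α : List 𝒜} (hα : α ∉ language X) : sWord R X α = 0 := by
  induction α using List.reverseRecOn with
  | nil => exact absurd h hα
  | append_singleton α a ih =>
    rw [sWord_append]
    by_cases hα' : α ∈ language X
    · have h0 := sStarWord_mul_sWord_mul_s_mul_sStar (R := R) hletters hα' hα
      rw [← sWord_mul_sStarWord_mul_sWord hX hletters hα', sWord_cons, sWord_nil, mul_one,
        ← s_mul_sStar_mul_s a]
      calc _ = sWord R X α * (sStarWord R X α * sWord R X α * (s R X a * sStar R X a)) *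
            s R X a := by noncomm_ring
        _ = 0 := by rw [h0]; simp
    · rw [ih hα', zero_mul]

theorem sStarWord_eq_zero (hX : IsSubshift X) (hletters : ∀ a : 𝒜, [a] ∈ language X)
    (h : [] ∈ language X) {α : List 𝒜} (hα : α ∉ language X) : sStarWord R X α = 0 := by
  induction α using List.reverseRecOn with
  | nil => exact absurd h hα
  | append_singleton α a ih =>
    rw [sStarWord_append]
    by_cases hα' : α ∈ language X
    · have h0 := sStarWord_mul_sWord_mul_s_mul_sStar (R := R) hletters hα' hα
      rw [← p_CU_nil_right (nil_mem_language_of_mem hα') hα',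
        ← p_CU_nil_singleton (nil_mem_language_of_mem hα') (hletters a), p_comm,
        p_CU_nil_right, p_CU_nil_singleton] at h0
      rw [← sStarWord_mul_sWord_mul_sStarWord hX hletters hα', sStarWord_cons, sStarWord_nil,
        one_mul, ← sStar_mul_s_mul_sStar a]
      calc _ = sStar R X a * (s R X a * sStar R X a * (sStarWord R X α * sWord R X α)) *
            sStarWord R X α := by noncomm_ring
        _ = 0 := by rw [h0]; simp
    · rw [ih hα', mul_zero]

/-- For `β` empty, the new set is the follower set of `αa`. For `β` starting with `a`, that letter
is removed and the factor `s_a^* s_a` is left over. For `β` starting with another letter,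
orthogonality of letters gives zero. -/
theorem exists_p_CU_mul_s (hX : IsSubshift X) (hletters : ∀ a : 𝒜, [a] ∈ language X)
    {α β : List 𝒜} (hα : α ∈ language X) (hβ : β ∈ language X) (a : 𝒜) :
    ∃ B : U X, p R X (CU X α β hα hβ) * s R X a = s R X a * p R X B := by
  have h := nil_mem_language_of_mem hα
  cases β with
  | nil =>
    have key : p R X (CU X α [] hα hβ) * s R X a =
        s R X a * (sStar R X a * (sStarWord R X α * sWord R X α) * s R X a) := by
      have hc := p_comm (R := R) (CU X α [] hα h) (CU X [] [a] h (hletters a))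
      rw [p_CU_nil_right, p_CU_nil_singleton] at hc
      rw [p_CU_nil_right]
      nth_rw 1 [← s_mul_sStar_mul_s a]
      rw [← mul_assoc, hc]
      noncomm_ring
    by_cases ha : α ++ [a] ∈ language X
    · refine ⟨CU X (α ++ [a]) [] ha h, ?_⟩
      rw [key, p_CU_nil_right, sWord_append, sStarWord_append]
      simp [sWord_cons, sStarWord_cons, mul_assoc]
    · refine ⟨⊥, ?_⟩
      have h0 := sStarWord_mul_sWord_mul_s_mul_sStar (R := R) hletters hα ha
      rw [p_bot, mul_zero, p_CU_nil_right, ← s_mul_sStar_mul_s a, ← mul_assoc, h0, zero_mul]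
  | cons b β =>
    rcases eq_or_ne b a with rfl | hba
    · have hβ' := hX.mem_language_of_cons hβ
      refine ⟨CU X α β hα hβ' ⊓ CU X [b] [] (hletters b) h, ?_⟩
      rw [← p_mul_p, p_CU_singleton_nil, p_CU, p_CU, sWord_cons, sStarWord_cons]
      noncomm_ring
    · refine ⟨⊥, ?_⟩
      rw [p_bot, mul_zero, p_CU, sStarWord_cons, ← mul_assoc, mul_assoc _ (sStar R X b),
        sStar_mul_s_of_ne hletters hba, mul_zero]

theorem exists_p_mul_s (hX : IsSubshift X) (hletters : ∀ a : 𝒜, [a] ∈ language X)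
    (A : U X) (a : 𝒜) : ∃ B : U X, p R X A * s R X a = s R X a * p R X B := by
  obtain ⟨A, hA⟩ := A
  refine BooleanSubalgebra.closure_bot_sup_induction
    (p := fun A hA => ∃ B : U X, p R X ⟨A, hA⟩ * s R X a = s R X a * p R X B)
    ?_ ?_ ?_ ?_ hA
  · rintro _ ⟨α, hα, β, hβ, rfl⟩
    exact exists_p_CU_mul_s hX hletters hα hβ a
  · refine ⟨⊥, ?_⟩
    have : p R X ⟨⊥, BooleanSubalgebra.bot_mem⟩ = 0 := p_bot
    rw [this]; simp
  · rintro A hA A' hA' ⟨B, hB⟩ ⟨B', hB'⟩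
    refine ⟨B ⊔ B', ?_⟩
    have : p R X ⟨A ⊔ A', BooleanSubalgebra.supClosed _ hA hA'⟩ = _ :=
      p_sup (R := R) (X := X) ⟨A, hA⟩ ⟨A', hA'⟩
    rw [this, p_sup, ← p_mul_p, ← p_mul_p]
    have hmul : p R X ⟨A, hA⟩ * p R X ⟨A', hA'⟩ * s R X a = s R X a * (p R X B * p R X B') := by
      rw [mul_assoc, hB', ← mul_assoc, hB, mul_assoc]
    rw [sub_mul, add_mul, hmul, hB, hB', mul_sub, mul_add]
  · rintro A hA ⟨B, hB⟩
    refine ⟨Bᶜ, ?_⟩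
    have : p R X ⟨Aᶜ, BooleanSubalgebra.compl_mem hA⟩ = _ := p_compl (R := R) (X := X) ⟨A, hA⟩
    rw [this, p_compl, sub_mul, one_mul, hB, mul_sub, mul_one]

theorem exists_p_mul_s_and_sStar_mul_p (hX : IsSubshift X)
    (hletters : ∀ a : 𝒜, [a] ∈ language X) (A : U X) (a : 𝒜) :
    ∃ B : U X, p R X A * s R X a = s R X a * p R X B ∧
      sStar R X a * p R X A = p R X B * sStar R X a := by
  obtain ⟨B, hB⟩ := exists_p_mul_s (R := R) hX hletters A a
  refine ⟨B, hB, ?_⟩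
  have h := nil_mem_language_of_mem (hletters a)
  have h1 := p_comm (R := R) (CU X [] [a] h (hletters a)) A
  have h2 := p_comm (R := R) (CU X [a] [] (hletters a) h) B
  rw [p_CU_nil_singleton] at h1
  rw [p_CU_singleton_nil] at h2
  -- The same `B` serves for `s_a^*`, because `s_a s_a^*` commutes with `p_A` and `s_a^* s_a` with
  -- `p_B`.
  calc sStar R X a * p R X A = sStar R X a * (s R X a * sStar R X a * p R X A) := by
        nth_rw 1 [← sStar_mul_s_mul_sStar a]; noncomm_ring
    _ = sStar R X a * (p R X A * s R X a) * sStar R X a := by rw [h1]; noncomm_ring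
    _ = (sStar R X a * s R X a * p R X B) * sStar R X a := by rw [hB]; noncomm_ring
    _ = p R X B * (sStar R X a * s R X a * sStar R X a) := by rw [h2]; noncomm_ring
    _ = _ := by rw [sStar_mul_s_mul_sStar]

theorem exists_p_mul_sWord (hX : IsSubshift X) (hletters : ∀ a : 𝒜, [a] ∈ language X)
    (A : U X) (α : List 𝒜) : ∃ B : U X, p R X A * sWord R X α = sWord R X α * p R X B := by
  induction α generalizing A with
  | nil => exact ⟨A, by simp⟩
  | cons a α ih =>
    obtain ⟨B, hB, -⟩ := exists_p_mul_s_and_sStar_mul_p (R := R) hX hletters A a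
    obtain ⟨B', hB'⟩ := ih B
    exact ⟨B', by rw [sWord_cons, ← mul_assoc, hB, mul_assoc, hB', mul_assoc]⟩

theorem exists_sStarWord_mul_p (hX : IsSubshift X) (hletters : ∀ a : 𝒜, [a] ∈ language X)
    (A : U X) (α : List 𝒜) :
    ∃ B : U X, sStarWord R X α * p R X A = p R X B * sStarWord R X α := by
  induction α generalizing A with
  | nil => exact ⟨A, by simp⟩
  | cons a α ih =>
    obtain ⟨B, -, hB⟩ := exists_p_mul_s_and_sStar_mul_p (R := R) hX hletters A a
    obtain ⟨B', hB'⟩ := ih B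
    exact ⟨B', by rw [sStarWord_cons, mul_assoc, hB, ← mul_assoc, hB', mul_assoc]⟩

end Commutation

/-! ### Spans with prescribed word lengths, and cuts. -/

section LengthSpan

variable {R : Type*} [CommRing R] {𝒜 : Type*} {X : Set (Stream' 𝒜)}

variable (R X) in
/-- The `R`-span of all `s_α p_A s_β^*` whose word lengths `|α|` and `|β|` are related by `P`. -/
noncomputable def lengthSpan (P : ℕ → ℕ → Prop) : Submodule R (UnitalSubshiftAlgebra R X) :=
  Submodule.span R {x | ∃ (α β : List 𝒜) (A : U X), P α.length β.length ∧
    x = sWord R X α * p R X A * sStarWord R X β}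

theorem mem_lengthSpan {P : ℕ → ℕ → Prop} {α β : List 𝒜} (A : U X)
    (h : P α.length β.length) :
    sWord R X α * p R X A * sStarWord R X β ∈ lengthSpan R X P :=
  Submodule.subset_span ⟨α, β, A, h, rfl⟩

theorem lengthSpan_mono {P Q : ℕ → ℕ → Prop} (h : ∀ i j, P i j → Q i j) :
    lengthSpan R X P ≤ lengthSpan R X Q := by
  refine Submodule.span_mono ?_
  rintro _ ⟨α, β, A, hP, rfl⟩
  exact ⟨α, β, A, h _ _ hP, rfl⟩

theorem eq_zero_of_mem_lengthSpan {P : ℕ → ℕ → Prop} (h : ∀ i j, ¬ P i j)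
    {x : UnitalSubshiftAlgebra R X} (hx : x ∈ lengthSpan R X P) : x = 0 := by
  have : lengthSpan R X P ≤ ⊥ := by
    refine Submodule.span_le.2 ?_
    rintro _ ⟨α, β, A, hP, rfl⟩
    exact absurd hP (h _ _)
  simpa using this hx

/-- A left multiplication maps `lengthSpan R X P` into a submodule as soon as it does so on the
spanning elements. -/
theorem mul_left_mem_of_mem_lengthSpan {P : ℕ → ℕ → Prop} {y : UnitalSubshiftAlgebra R X}
    {M : Submodule R (UnitalSubshiftAlgebra R X)}
    (h : ∀ α β : List 𝒜, ∀ A : U X, P α.length β.length →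
      y * (sWord R X α * p R X A * sStarWord R X β) ∈ M)
    {x : UnitalSubshiftAlgebra R X} (hx : x ∈ lengthSpan R X P) : y * x ∈ M := by
  have : lengthSpan R X P ≤ M.comap (LinearMap.mulLeft R y) := by
    refine Submodule.span_le.2 ?_
    rintro _ ⟨α, β, A, hP, rfl⟩
    exact h α β A hP
  exact this hx

theorem mul_right_mem_of_mem_lengthSpan {P : ℕ → ℕ → Prop} {y : UnitalSubshiftAlgebra R X}
    {M : Submodule R (UnitalSubshiftAlgebra R X)}
    (h : ∀ α β : List 𝒜, ∀ A : U X, P α.length β.length →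
      sWord R X α * p R X A * sStarWord R X β * y ∈ M)
    {x : UnitalSubshiftAlgebra R X} (hx : x ∈ lengthSpan R X P) : x * y ∈ M := by
  have : lengthSpan R X P ≤ M.comap (LinearMap.mulRight R y) := by
    refine Submodule.span_le.2 ?_
    rintro _ ⟨α, β, A, hP, rfl⟩
    exact h α β A hP
  exact this hx

theorem s_mul_mem_lengthSpan {P Q : ℕ → ℕ → Prop} (a : 𝒜) (h : ∀ i j, P i j → Q (i + 1) j)
    {x : UnitalSubshiftAlgebra R X} (hx : x ∈ lengthSpan R X P) :
    s R X a * x ∈ lengthSpan R X Q := by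
  refine mul_left_mem_of_mem_lengthSpan (fun α β A hP => ?_) hx
  rw [← mul_assoc, ← mul_assoc, ← sWord_cons]
  exact mem_lengthSpan A (h _ _ hP)

theorem p_mul_mem_lengthSpan (hX : IsSubshift X) (hletters : ∀ a : 𝒜, [a] ∈ language X)
    {P : ℕ → ℕ → Prop} (A : U X) {x : UnitalSubshiftAlgebra R X} (hx : x ∈ lengthSpan R X P) :
    p R X A * x ∈ lengthSpan R X P := by
  refine mul_left_mem_of_mem_lengthSpan (fun α β A' hP => ?_) hx
  obtain ⟨B, hB⟩ := exists_p_mul_sWord (R := R) hX hletters A α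
  rw [← mul_assoc, ← mul_assoc, hB, mul_assoc (sWord R X α), p_mul_p]
  exact mem_lengthSpan _ hP

theorem mul_p_mem_lengthSpan (hX : IsSubshift X) (hletters : ∀ a : 𝒜, [a] ∈ language X)
    {P : ℕ → ℕ → Prop} (A : U X) {x : UnitalSubshiftAlgebra R X} (hx : x ∈ lengthSpan R X P) :
    x * p R X A ∈ lengthSpan R X P := by
  refine mul_right_mem_of_mem_lengthSpan (fun α β A' hP => ?_) hx
  obtain ⟨B, hB⟩ := exists_sStarWord_mul_p (R := R) hX hletters A β
  rw [mul_assoc, hB, ← mul_assoc, mul_assoc (sWord R X α), p_mul_p]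
  exact mem_lengthSpan _ hP

/-- Either `s_a^*` meets the first letter of `α` and cancels it (or gives zero), or `α` is empty and
`s_a^*` passes `p_A` to lengthen `β`; `h` and `h0` record the two effects on the lengths. -/
theorem sStar_mul_mem_lengthSpan (hX : IsSubshift X) (hletters : ∀ a : 𝒜, [a] ∈ language X)
    {P Q : ℕ → ℕ → Prop} (a : 𝒜) (h : ∀ i j, P (i + 1) j → Q i j)
    (h0 : ∀ j, P 0 j → Q 0 (j + 1))
    {x : UnitalSubshiftAlgebra R X} (hx : x ∈ lengthSpan R X P) :
    sStar R X a * x ∈ lengthSpan R X Q := by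
  refine mul_left_mem_of_mem_lengthSpan (fun α β A hP => ?_) hx
  cases α with
  | nil =>
    obtain ⟨B, -, hB⟩ := exists_p_mul_s_and_sStar_mul_p (R := R) hX hletters A a
    rw [← mul_assoc, sWord_nil, one_mul, hB]
    have := mem_lengthSpan (R := R) (P := Q) (α := []) (β := β ++ [a]) B
      (by simpa using h0 _ hP)
    simpa [sStarWord_append, sStarWord_cons, mul_assoc] using this
  | cons b α =>
    rcases eq_or_ne a b with rfl | hab
    · have h1 := p_CU_singleton_nil (R := R) (nil_mem_language_of_mem (hletters a)) (hletters a)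
      rw [sWord_cons, mul_assoc, mul_assoc, ← mul_assoc, ← h1, ← mul_assoc (sWord R X α)]
      exact p_mul_mem_lengthSpan hX hletters _ (mem_lengthSpan A (h _ _ hP))
    · rw [sWord_cons, mul_assoc, mul_assoc, ← mul_assoc, sStar_mul_s_of_ne hletters hab, zero_mul]
      exact zero_mem _

theorem mul_s_mem_lengthSpan (hX : IsSubshift X) (hletters : ∀ a : 𝒜, [a] ∈ language X)
    {P Q : ℕ → ℕ → Prop} (a : 𝒜) (h : ∀ i j, P i (j + 1) → Q i j)
    (h0 : ∀ i, P i 0 → Q (i + 1) 0)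
    {x : UnitalSubshiftAlgebra R X} (hx : x ∈ lengthSpan R X P) :
    x * s R X a ∈ lengthSpan R X Q := by
  refine mul_right_mem_of_mem_lengthSpan (fun α β A hP => ?_) hx
  cases β with
  | nil =>
    obtain ⟨B, hB, -⟩ := exists_p_mul_s_and_sStar_mul_p (R := R) hX hletters A a
    rw [sStarWord_nil, mul_one, mul_assoc, hB]
    have := mem_lengthSpan (R := R) (P := Q) (α := α ++ [a]) (β := []) B
      (by simpa using h0 _ hP)
    simpa [sWord_append, sWord_cons, mul_assoc] using this
  | cons b β =>
    rcases eq_or_ne b a with rfl | hba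
    · have h1 := p_CU_singleton_nil (R := R) (nil_mem_language_of_mem (hletters b)) (hletters b)
      rw [sStarWord_cons, mul_assoc, mul_assoc (sStarWord R X β), ← h1, ← mul_assoc]
      exact mul_p_mem_lengthSpan hX hletters _ (mem_lengthSpan A (h _ _ hP))
    · rw [sStarWord_cons, mul_assoc, mul_assoc (sStarWord R X β), sStar_mul_s_of_ne hletters hba,
        mul_zero, mul_zero]
      exact zero_mem _

theorem lengthSpan_true (hX : IsSubshift X) (hletters : ∀ a : 𝒜, [a] ∈ language X) :
    lengthSpan R X (fun _ _ => True) = ⊤ := by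
  -- The span contains `1` and is stable under left multiplication by each generator, so it is
  -- everything.
  have key : ∀ f : FreeAlgebra R (Gen X), ∀ x ∈ lengthSpan R X (fun _ _ => True),
      RingQuot.mkAlgHom R (Rel R X) f * x ∈ lengthSpan R X (fun _ _ => True) := by
    intro f
    induction f using FreeAlgebra.induction with
    | grade0 r =>
      intro x hx
      rw [AlgHom.commutes, ← Algebra.smul_def]
      exact Submodule.smul_mem _ r hx
    | grade1 g =>
      intro x hx
      cases g with
      | p A => exact p_mul_mem_lengthSpan hX hletters A hx
      | s a =>
        have := s_mul_mem_lengthSpan (Q := fun _ _ => True) a (fun _ _ _ => trivial) hx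
        exact this
      | sStar a =>
        have := sStar_mul_mem_lengthSpan (Q := fun _ _ => True) hX hletters a
          (fun _ _ _ => trivial) (fun _ _ => trivial) hx
        exact this
    | mul f g hf hg =>
      intro x hx
      rw [map_mul, mul_assoc]
      exact hf _ (hg _ hx)
    | add f g hf hg =>
      intro x hx
      rw [map_add, add_mul]
      exact add_mem (hf _ hx) (hg _ hx)
  refine eq_top_iff.2 fun x _ => ?_
  obtain ⟨f, rfl⟩ := RingQuot.mkAlgHom_surjective R (Rel R X) x
  rw [← mul_one (RingQuot.mkAlgHom R (Rel R X) f)]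
  refine key f 1 ?_
  simpa using mem_lengthSpan (R := R) (X := X) (P := fun _ _ => True) (α := []) (β := [])
    ⊤ trivial

theorem lengthSpan_le_component (hX : IsSubshift X) (hletters : ∀ a : 𝒜, [a] ∈ language X)
    (h : [] ∈ language X) (n : ℤ) :
    lengthSpan R X (fun i j => (i : ℤ) - j = n) ≤ component R X n := by
  refine Submodule.span_le.2 ?_
  rintro _ ⟨α, β, A, hn, rfl⟩
  by_cases hα : α ∈ language X
  · by_cases hβ : β ∈ language X
    · exact Submodule.subset_span ⟨α, hα, β, hβ, A, hn, rfl⟩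
    · rw [sStarWord_eq_zero hX hletters h hβ, mul_zero]
      exact zero_mem _
  · rw [sWord_eq_zero hX hletters h hα, zero_mul, zero_mul]
    exact zero_mem _

theorem component_le_lengthSpan (n : ℤ) :
    component R X n ≤ lengthSpan R X (fun i j => (i : ℤ) - j = n) := by
  refine Submodule.span_mono ?_
  rintro _ ⟨α, -, β, -, A, hn, rfl⟩
  exact ⟨α, β, A, hn, rfl⟩

theorem iSup_component (hX : IsSubshift X) (hletters : ∀ a : 𝒜, [a] ∈ language X)
    (h : [] ∈ language X) : ⨆ n, component R X n = ⊤ := by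
  rw [eq_top_iff, ← lengthSpan_true hX hletters]
  refine Submodule.span_le.2 ?_
  rintro _ ⟨α, β, A, -, rfl⟩
  exact Submodule.mem_iSup_of_mem _
    (lengthSpan_le_component hX hletters h _ (mem_lengthSpan A rfl))

/-- `q` acts as the identity on the elements annihilated by all letters. -/
structure IsCut (q : UnitalSubshiftAlgebra R X) : Prop where
  mul_eq : ∀ y, (∀ a, y * s R X a = 0) → y * q = y
  eq_mul : ∀ y, (∀ a, sStar R X a * y = 0) → q * y = y

theorem isCut_one : IsCut (1 : UnitalSubshiftAlgebra R X) := ⟨by simp, by simp⟩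

theorem IsCut.mul {q q' : UnitalSubshiftAlgebra R X} (hq : IsCut q) (hq' : IsCut q') :
    IsCut (q * q') where
  mul_eq y hy := by rw [← mul_assoc, hq.mul_eq y hy, hq'.mul_eq y hy]
  eq_mul y hy := by rw [mul_assoc, hq'.eq_mul y hy, hq.eq_mul y hy]

theorem isCut_one_sub (a : 𝒜) : IsCut (1 - s R X a * sStar R X a) where
  mul_eq y hy := by rw [mul_sub, ← mul_assoc, hy a]; simp
  eq_mul y hy := by rw [sub_mul, mul_assoc, hy a]; simp

theorem exists_isCut_mul_sWord (hletters : ∀ a : 𝒜, [a] ∈ language X) (α : List 𝒜)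
    (hα : α ≠ []) : ∃ C : U X, IsCut (p R X C) ∧ p R X C * sWord R X α = 0 ∧
      sStarWord R X α * p R X C = 0 := by
  cases α with
  | nil => exact absurd rfl hα
  | cons a α =>
    have h := nil_mem_language_of_mem (hletters a)
    have hC : p R X (CU X [] [a] h (hletters a))ᶜ = 1 - s R X a * sStar R X a := by
      rw [p_compl, p_CU_nil_singleton]
    refine ⟨(CU X [] [a] h (hletters a))ᶜ, ?_, ?_, ?_⟩
    · rw [hC]
      exact isCut_one_sub a
    · rw [hC, sWord_cons, ← mul_assoc, sub_mul, s_mul_sStar_mul_s]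
      simp
    · rw [hC, sStarWord_cons, mul_assoc, mul_sub, ← mul_assoc (sStar R X a),
        sStar_mul_s_mul_sStar]
      simp

/-- Each spanning term with `α` nonempty is killed by the cut at its first letter. For a sum the
cuts are multiplied; they commute, and further projections do not change word lengths. -/
theorem exists_isCut_left (hX : IsSubshift X) (hletters : ∀ a : 𝒜, [a] ∈ language X)
    {P : ℕ → ℕ → Prop} {x : UnitalSubshiftAlgebra R X} (hx : x ∈ lengthSpan R X P) :
    ∃ C : U X, IsCut (p R X C) ∧ p R X C * x ∈ lengthSpan R X (fun i j => P i j ∧ i = 0) := by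
  induction hx using Submodule.span_induction with
  | mem x hx =>
    obtain ⟨α, β, A, hP, rfl⟩ := hx
    rcases eq_or_ne α [] with rfl | hα
    · refine ⟨⊤, by rw [p_top]; exact isCut_one, ?_⟩
      rw [p_top, one_mul]
      exact mem_lengthSpan A ⟨hP, rfl⟩
    · obtain ⟨C, hC, h0, -⟩ := exists_isCut_mul_sWord (R := R) hletters α hα
      refine ⟨C, hC, ?_⟩
      rw [← mul_assoc, ← mul_assoc, h0, zero_mul, zero_mul]
      exact zero_mem _
  | zero => exact ⟨⊤, by rw [p_top]; exact isCut_one, by simp⟩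
  | add x y _ _ hx hy =>
    obtain ⟨C, hC, hCx⟩ := hx
    obtain ⟨D, hD, hDy⟩ := hy
    refine ⟨C ⊓ D, by rw [← p_mul_p]; exact hC.mul hD, ?_⟩
    rw [mul_add]
    refine add_mem ?_ ?_
    · rw [← p_mul_p, p_comm, mul_assoc]
      exact p_mul_mem_lengthSpan hX hletters D hCx
    · rw [← p_mul_p, mul_assoc]
      exact p_mul_mem_lengthSpan hX hletters C hDy
  | smul r x _ hx =>
    obtain ⟨C, hC, hCx⟩ := hx
    refine ⟨C, hC, ?_⟩
    rw [mul_smul_comm]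
    exact Submodule.smul_mem _ r hCx

theorem exists_isCut_right (hX : IsSubshift X) (hletters : ∀ a : 𝒜, [a] ∈ language X)
    {P : ℕ → ℕ → Prop} {x : UnitalSubshiftAlgebra R X} (hx : x ∈ lengthSpan R X P) :
    ∃ C : U X, IsCut (p R X C) ∧ x * p R X C ∈ lengthSpan R X (fun i j => P i j ∧ j = 0) := by
  induction hx using Submodule.span_induction with
  | mem x hx =>
    obtain ⟨α, β, A, hP, rfl⟩ := hx
    rcases eq_or_ne β [] with rfl | hβ
    · refine ⟨⊤, by rw [p_top]; exact isCut_one, ?_⟩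
      rw [p_top, mul_one]
      exact mem_lengthSpan A ⟨hP, rfl⟩
    · obtain ⟨C, hC, -, h0⟩ := exists_isCut_mul_sWord (R := R) hletters β hβ
      refine ⟨C, hC, ?_⟩
      rw [mul_assoc, h0, mul_zero]
      exact zero_mem _
  | zero => exact ⟨⊤, by rw [p_top]; exact isCut_one, by simp⟩
  | add x y _ _ hx hy =>
    obtain ⟨C, hC, hCx⟩ := hx
    obtain ⟨D, hD, hDy⟩ := hy
    refine ⟨C ⊓ D, by rw [← p_mul_p]; exact hC.mul hD, ?_⟩
    rw [add_mul]
    refine add_mem ?_ ?_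
    · rw [← p_mul_p, ← mul_assoc]
      exact mul_p_mem_lengthSpan hX hletters D hCx
    · rw [← p_mul_p, p_comm, ← mul_assoc]
      exact mul_p_mem_lengthSpan hX hletters C hDy
  | smul r x _ hx =>
    obtain ⟨C, hC, hCx⟩ := hx
    refine ⟨C, hC, ?_⟩
    rw [smul_mul_assoc]
    exact Submodule.smul_mem _ r hCx

end LengthSpan

/-! ### The kernel of `η` on homogeneous elements. -/

section Kernel

variable {R : Type*} [CommRing R] {𝒜 : Type*} {X : Set (Stream' 𝒜)}

/-- An element of the span of the `p_A` acts as a scalar on sufficiently many `p_B`: an element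
`y` vanishing against all of these is zero. -/
theorem eq_zero_of_mul_p_eq_zero {x : UnitalSubshiftAlgebra R X}
    (hx : x ∈ Submodule.span R (Set.range (p R X))) (y : UnitalSubshiftAlgebra R X)
    (h : ∀ (B : U X) (r : R), x * p R X B = r • p R X B → y * p R X B = 0) : y = 0 := by
  -- Keeping `y` general is what makes sums work: the claim for `x'` is applied to `y p_B`, and on
  -- `B ⊓ B'` the sum acts as `r + r'`.
  induction hx using Submodule.span_induction generalizing y with
  | mem x hx =>
    obtain ⟨A, rfl⟩ := hx
    have h1 := h A 1 (by rw [p_mul_p, inf_idem, one_smul])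
    have h2 := h Aᶜ 0 (by rw [p_mul_p, inf_compl_eq_bot, p_bot, zero_smul])
    rwa [p_compl, mul_sub, mul_one, h1, sub_zero] at h2
  | zero => simpa using h ⊤ 0
  | add x x' _ _ hx hx' =>
    refine hx y fun B r hB => hx' _ fun B' r' hB' => ?_
    rw [mul_assoc, p_mul_p]
    refine h _ (r + r') ?_
    rw [add_mul, ← p_mul_p, ← mul_assoc, hB, p_comm B B', ← mul_assoc x', hB', add_smul,
      smul_mul_assoc, smul_mul_assoc, p_comm B B']
  | smul c x _ hx =>
    exact hx y fun B r hB => h B (c * r) (by rw [smul_mul_assoc, hB, mul_smul])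

variable {S : Type*} [NonUnitalRing S] {η : UnitalSubshiftAlgebra R X →ₙ+* S}

theorem eq_zero_of_mem_span_p
    (hη : ∀ r : R, r ≠ 0 → ∀ A : U X, (A : Set X).Nonempty → η (r • p R X A) ≠ 0)
    {x : UnitalSubshiftAlgebra R X} (hx : x ∈ Submodule.span R (Set.range (p R X)))
    (h0 : η x = 0) : x = 0 := by
  refine eq_zero_of_mul_p_eq_zero hx x fun B r hB => ?_
  rw [hB]
  by_contra hne
  have hr : r ≠ 0 := by rintro rfl; simp at hne
  have hBne : (B : Set X).Nonempty := by
    rw [Set.nonempty_iff_ne_empty]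
    intro hB0
    have : B = ⊥ := Subtype.ext hB0
    rw [this, p_bot, smul_zero] at hne
    exact hne rfl
  refine hη r hr B hBne ?_
  rw [← hB, map_mul, h0, zero_mul]

/-- The induction bounds the common length of `α` and `β`: passing to `s_a^* x s_b` lowers the
bound, and cuts recover `x` from these products. -/
theorem eq_zero_of_mem_lengthSpan_diag (hX : IsSubshift X)
    (hletters : ∀ a : 𝒜, [a] ∈ language X)
    (hη : ∀ r : R, r ≠ 0 → ∀ A : U X, (A : Set X).Nonempty → η (r • p R X A) ≠ 0)
    (m : ℕ) {x : UnitalSubshiftAlgebra R X} (hx : x ∈ lengthSpan R X (fun i j => i = j ∧ i ≤ m))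
    (h0 : η x = 0) : x = 0 := by
  have base : ∀ x ∈ lengthSpan R X (fun i j => i = j ∧ i = 0), η x = 0 → x = 0 := by
    intro x hx h0
    refine eq_zero_of_mem_span_p hη (?_ : x ∈ _) h0
    refine (Submodule.span_le (p := Submodule.span R (Set.range (p R X)))).2 ?_ hx
    rintro _ ⟨α, β, A, ⟨hαβ, hα⟩, rfl⟩
    rw [hα] at hαβ
    rw [List.eq_nil_of_length_eq_zero hα, List.eq_nil_of_length_eq_zero hαβ.symm]
    exact Submodule.subset_span ⟨A, by simp⟩
  induction m generalizing x with
  | zero => exact base x (lengthSpan_mono (fun i j h => by omega) hx) h0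
  | succ m ih =>
    have hab : ∀ a b, sStar R X a * (x * s R X b) = 0 := by
      intro a b
      refine ih (x := sStar R X a * (x * s R X b)) ?_ (by simp [map_mul, h0])
      have h1 : x * s R X b ∈ lengthSpan R X (fun i j => i = j + 1 ∧ i ≤ m + 1) :=
        mul_s_mem_lengthSpan hX hletters b (fun i j h => by omega) (fun i h => by omega) hx
      exact sStar_mul_mem_lengthSpan hX hletters a (fun i j h => by omega)
        (fun j h => by omega) h1
    -- On the diagonal, killing one of the two words kills both, so `p_C x` and `x p_D` lie in the
    -- span of the `p_A`.
    obtain ⟨C, hC, hCx⟩ := exists_isCut_left hX hletters hx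
    obtain ⟨D, hD, hDx⟩ := exists_isCut_right hX hletters hx
    have hCx0 : p R X C * x = 0 :=
      base _ (lengthSpan_mono (fun i j h => by omega) hCx) (by simp [map_mul, h0])
    have hDx0 : x * p R X D = 0 :=
      base _ (lengthSpan_mono (fun i j h => by omega) hDx) (by simp [map_mul, h0])
    -- Each `x s_b` is annihilated by every `s_a^*`, so the left cut fixes it; then the right cut
    -- fixes `x`.
    have hb : ∀ b, x * s R X b = 0 := fun b => by
      rw [← hC.eq_mul _ fun a => hab a b, ← mul_assoc, hCx0, zero_mul]
    rw [← hD.mul_eq x hb, hDx0]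

theorem exists_mem_lengthSpan_le {P : ℕ → ℕ → Prop} {x : UnitalSubshiftAlgebra R X}
    (hx : x ∈ lengthSpan R X P) : ∃ m, x ∈ lengthSpan R X (fun i j => P i j ∧ i ≤ m) := by
  induction hx using Submodule.span_induction with
  | mem x hx =>
    obtain ⟨α, β, A, hP, rfl⟩ := hx
    exact ⟨α.length, mem_lengthSpan A ⟨hP, le_rfl⟩⟩
  | zero => exact ⟨0, zero_mem _⟩
  | add x y _ _ hx hy =>
    obtain ⟨m, hm⟩ := hx
    obtain ⟨k, hk⟩ := hy
    exact ⟨max m k, add_mem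
      (lengthSpan_mono (fun i j h => ⟨h.1, h.2.trans (le_max_left m k)⟩) hm)
      (lengthSpan_mono (fun i j h => ⟨h.1, h.2.trans (le_max_right m k)⟩) hk)⟩
  | smul r x _ hx =>
    obtain ⟨m, hm⟩ := hx
    exact ⟨m, Submodule.smul_mem _ r hm⟩

/-- Each `s_a^* x` has degree one less, so it vanishes by induction and `x` equals its own cut. The
cut demands `i = 0`, which is incompatible with `i = j + k + 1`. -/
theorem eq_zero_of_mem_lengthSpan_add_left (hX : IsSubshift X)
    (hletters : ∀ a : 𝒜, [a] ∈ language X)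
    (hη : ∀ r : R, r ≠ 0 → ∀ A : U X, (A : Set X).Nonempty → η (r • p R X A) ≠ 0)
    (k : ℕ) {x : UnitalSubshiftAlgebra R X} (hx : x ∈ lengthSpan R X (fun i j => i = j + k))
    (h0 : η x = 0) : x = 0 := by
  induction k generalizing x with
  | zero =>
    obtain ⟨m, hm⟩ := exists_mem_lengthSpan_le hx
    exact eq_zero_of_mem_lengthSpan_diag hX hletters hη m hm h0
  | succ k ih =>
    have ha : ∀ a, sStar R X a * x = 0 := fun a =>
      ih (sStar_mul_mem_lengthSpan hX hletters a (fun i j h => by omega)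
        (fun j h => by omega) hx) (by simp [map_mul, h0])
    obtain ⟨C, hC, hCx⟩ := exists_isCut_left hX hletters hx
    rw [← hC.eq_mul x ha]
    exact eq_zero_of_mem_lengthSpan (fun i j h => by omega) hCx

theorem eq_zero_of_mem_lengthSpan_add_right (hX : IsSubshift X)
    (hletters : ∀ a : 𝒜, [a] ∈ language X)
    (hη : ∀ r : R, r ≠ 0 → ∀ A : U X, (A : Set X).Nonempty → η (r • p R X A) ≠ 0)
    (k : ℕ) {x : UnitalSubshiftAlgebra R X} (hx : x ∈ lengthSpan R X (fun i j => j = i + k))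
    (h0 : η x = 0) : x = 0 := by
  induction k generalizing x with
  | zero =>
    exact eq_zero_of_mem_lengthSpan_add_left hX hletters hη 0
      (lengthSpan_mono (fun i j h => by omega) hx) h0
  | succ k ih =>
    have ha : ∀ a, x * s R X a = 0 := fun a =>
      ih (mul_s_mem_lengthSpan hX hletters a (fun i j h => by omega)
        (fun j h => by omega) hx) (by simp [map_mul, h0])
    obtain ⟨C, hC, hCx⟩ := exists_isCut_right hX hletters hx
    rw [← hC.mul_eq x ha]
    exact eq_zero_of_mem_lengthSpan (fun i j h => by omega) hCx

theorem eq_zero_of_mem_component (hX : IsSubshift X) (hletters : ∀ a : 𝒜, [a] ∈ language X)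
    (hη : ∀ r : R, r ≠ 0 → ∀ A : U X, (A : Set X).Nonempty → η (r • p R X A) ≠ 0)
    {n : ℤ} {x : UnitalSubshiftAlgebra R X} (hx : x ∈ component R X n) (h0 : η x = 0) :
    x = 0 := by
  have hx' := component_le_lengthSpan n hx
  rcases Int.eq_nat_or_neg n with ⟨k, rfl | rfl⟩
  · exact eq_zero_of_mem_lengthSpan_add_left hX hletters hη k
      (lengthSpan_mono (fun i j h => by omega) hx') h0
  · exact eq_zero_of_mem_lengthSpan_add_right hX hletters hη k
      (lengthSpan_mono (fun i j h => by omega) hx') h0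

/-- An additive map that respects gradings and is injective on the homogeneous components is
injective. -/
theorem _root_.DirectSum.injective_of_injective_on_components {ι M N σ τ : Type*} [DecidableEq ι]
    [AddCommGroup M] [AddCommGroup N] [SetLike σ M] [AddSubmonoidClass σ M]
    [SetLike τ N] [AddSubmonoidClass τ N] {ℳ : ι → σ} {𝒩 : ι → τ}
    (hM : Function.Surjective (DirectSum.coeAddMonoidHom ℳ)) (hN : DirectSum.IsInternal 𝒩)
    (f : M →+ N) (hf : ∀ i, ∀ x ∈ ℳ i, f x ∈ 𝒩 i)
    (hinj : ∀ i, ∀ x ∈ ℳ i, f x = 0 → x = 0) : Function.Injective f := by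
  refine (injective_iff_map_eq_zero f).2 fun x hx => ?_
  -- Some decomposition of `x` suffices; directness is needed only in the target, where it makes
  -- every component of the image vanish.
  obtain ⟨y, rfl⟩ := hM x
  let g : ∀ i, ℳ i →+ 𝒩 i := fun i =>
    { toFun := fun z => ⟨f z, hf i z z.2⟩
      map_zero' := Subtype.ext (by simp)
      map_add' := fun a b => Subtype.ext (by simp) }
  have hcomp : (DirectSum.coeAddMonoidHom 𝒩).comp (DirectSum.map g) =
      f.comp (DirectSum.coeAddMonoidHom ℳ) := by
    refine DirectSum.addHom_ext fun i z => ?_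
    simp [g]
  have h0 : DirectSum.map g y = 0 := by
    apply hN.injective
    rw [map_zero]
    exact (DFunLike.congr_fun hcomp y).trans hx
  have hy : y = 0 := by
    ext i
    have hi := DFunLike.congr_fun h0 i
    rw [DirectSum.map_apply] at hi
    exact hinj i _ (y i).2 (congrArg Subtype.val hi)
  rw [hy, map_zero]

end Kernel

end SubshiftAlgebra

theorem mainTheorem12 {R : Type*} [CommRing R] {𝒜 : Type*} (X : Set (Stream' 𝒜))
    (hX : SubshiftAlgebra.IsSubshift X)
    (hletters : ∀ a : 𝒜, [a] ∈ SubshiftAlgebra.language X)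
    {S : Type*} [NonUnitalRing S] (𝒮 : ℤ → AddSubgroup S)
    (hS : DirectSum.IsInternal 𝒮) [SetLike.GradedMul 𝒮]
    (η : SubshiftAlgebra.UnitalSubshiftAlgebra R X →ₙ+* S)
    (hgraded : ∀ (n : ℤ), ∀ x ∈ SubshiftAlgebra.component R X n, η x ∈ 𝒮 n)
    (hη : ∀ r : R, r ≠ 0 → ∀ A : SubshiftAlgebra.U X, (A : Set X).Nonempty →
      η (r • SubshiftAlgebra.p R X A) ≠ 0) :
    Function.Injective η := by
  open SubshiftAlgebra in
  -- For `X` empty even the empty word is outside the language and all components are zero, but then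
  -- `1 = p_X = p_∅ = 0` and the algebra is trivial.
  rcases X.eq_empty_or_nonempty with hXe | ⟨x, hx⟩
  · have h10 : (1 : UnitalSubshiftAlgebra R X) = 0 := by
      have : (⊤ : U X) = ⊥ := Subtype.ext <| Set.eq_empty_iff_forall_notMem.2 fun y _ => by
        have := y.2
        simp [hXe] at this
      rw [← p_top, this, p_bot]
    intro a b _
    rw [← one_mul a, ← one_mul b, h10, zero_mul, zero_mul]
  · have h : [] ∈ language X := ⟨x, hx, rfl⟩
    refine DirectSum.injective_of_injective_on_components (ℳ := component R X) ?_ hS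
      η.toAddMonoidHom hgraded fun n x hx h0 => eq_zero_of_mem_component hX hletters hη hx h0
    intro x
    obtain ⟨y, hy⟩ := (Submodule.mem_iSup_iff_exists_dfinsupp (component R X) x).1
      (by rw [iSup_component hX hletters h]; trivial)
    exact ⟨y, hy⟩
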